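/- For $s\in\{-1,1\}^n$ let $h(s)$ be the sum of the entries of $s$. Fix $\delta>0$, an integer $l\ge 1$, and a rounding rule $x\mapsto[x]\in\mathbb{N}$ for real $x\ge 0$ with $|[x]-x|<1$. The Fractal Random Walk $\mathrm{FRW}_{\delta,l}(2^i l)$, a distribution on $\{-1,1\}^{2^i l}$, is defined recursively. $\mathrm{FRW}_{\delta,l}(l)$ is uniform on $\{-1,1\}^l$. To sample from $\mathrm{FRW}_{\delta,l}(2n)$, draw $s_1,s_2$ independently from $\mathrm{FRW}_{\delta,l}(n)$. If $h(s_1)>0$, change exactly $[\delta h(s_1)]$ of the entries $-1$ of $s_2$ to $1$ (all of them, if there are fewer); if $h(s_1)<0$, change exactly $[\delta |h(s_1)|]$ of the entries $1$ of $s_2$ to $-1$ (all of them, if there are fewer); if $h(s_1)=0$, change nothing. With $s_2'$ the resulting sequence, output the concatenation $s_1s_2'$. Which of the admissible entries are changed may be decided by any, possibly randomized, rule depending on $s_1,s_2$. **Theorem.** There are absolute constants $\delta_0,c_1,c_2,C,K>0$ and $T_0\in\mathbb{N}$ such that the following holds for all $0<\delta\le\delta_0$, every rounding rule, every rule for selecting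 the changed entries, and all $T=2^i l$ with $100\log T\le l\le\sqrt T$. Let $S\sim \mathrm{FRW}_{\delta,l}(T)$. 1. If $\delta\log T\ge K$, then $$\Pr\left[T^{1/2+c_1\delta}\le |h(S)|\le T^{1/2+c_2\delta}\right]\ \ge\ \tfrac12-T^{-10}.$$ 2. If $T\ge T_0$, then $$\Pr\left[C^{-1}\,T^{1/2+c_1\delta}\le |h(S)|\le C\,T^{1/2+c_2\delta}\right]\ \ge\ \tfrac12-T^{-10}.$$ -/

import Mathlib

/-- The height of a sequence of signs: the sum of its entries. -/
def height (s : List ℤˣ) : ℤ := (s.map fun x => (x : ℤ)).sum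

/-- `IsFlip b k s s'`: the sequence `s'` arises from `s` by changing exactly `k` of the entries
`-b` of `s` to `b`, or all of them if there are fewer than `k`; all other entries are unchanged.
(As only changes from `-b` to `b` occur, the number of changes is the increase of the number of
entries `b`.) -/
def IsFlip (b : ℤˣ) (k : ℕ) (s s' : List ℤˣ) : Prop :=
  List.Forall₂ (fun x y => y = x ∨ (x = -b ∧ y = b)) s s' ∧
    s'.count b = s.count b + min k (s.count (-b))

/-- A rule that turns a nonnegative real number of flips into an integral one, moving it by less
than `1` (rounding down, up, or to the nearest integer, for example). -/
def IsRounding (rd : ℝ → ℕ) : Prop := ∀ x : ℝ, 0 ≤ x → |(rd x : ℝ) - x| < 1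

/-- The change of the second half `s₂`, given the first half `s₁`: if `s₁` has positive height,
`δ * h(s₁)` (rounded) entries `-1` of `s₂` become `1`; if `s₁` has negative height,
`δ * |h(s₁)|` (rounded) entries `1` of `s₂` become `-1`. -/
def IsUpdate (δ : ℝ) (rd : ℝ → ℕ) (s₁ s₂ s₂' : List ℤˣ) : Prop :=
  (0 < height s₁ → IsFlip 1 (rd (δ * |(height s₁ : ℝ)|)) s₂ s₂') ∧
  (height s₁ < 0 → IsFlip (-1) (rd (δ * |(height s₁ : ℝ)|)) s₂ s₂') ∧
  (height s₁ = 0 → s₂' = s₂)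

/-- A (possibly randomized) way of selecting which of the admissible entries are flipped. -/
structure FlipRule (δ : ℝ) (rd : ℝ → ℕ) where
  /-- the law of the changed second half, given both halves -/
  law : List ℤˣ → List ℤˣ → PMF (List ℤˣ)
  isUpdate : ∀ s₁ s₂ s₂' : List ℤˣ, s₂' ∈ (law s₁ s₂).support → IsUpdate δ rd s₁ s₂ s₂'

/-- The fractal random walk of length `2 ^ i * l` with base length `l`: a uniformly random element
of `{-1, 1} ^ l` for `i = 0`; for `i + 1`, the concatenation `s₁ s₂'`, where `s₁` and `s₂` are
independent fractal random walks of length `2 ^ i * l` and `s₂'` is `s₂` after the flips that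
`s₁` prescribes. -/
noncomputable def fractalRandomWalk {δ : ℝ} {rd : ℝ → ℕ} (rule : FlipRule δ rd) (l : ℕ) :
    ℕ → PMF (List ℤˣ)
  | 0 => (PMF.uniformOfFintype (Fin l → ℤˣ)).map List.ofFn
  | i + 1 =>
    (fractalRandomWalk rule l i).bind fun s₁ =>
      (fractalRandomWalk rule l i).bind fun s₂ =>
        (rule.law s₁ s₂).map fun s₂' => s₁ ++ s₂'

/-- The probability, as a real number, of an event under a discrete distribution. -/
noncomputable def prob {α : Type} (p : PMF α) (A : Set α) : ℝ := (p.toOuterMeasure A).toReal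

/-- Flip the first `k` entries `-b`. -/
def flipFirst (b : ℤˣ) : ℕ → List ℤˣ → List ℤˣ
  | 0, s => s
  | _ + 1, [] => []
  | k + 1, x :: s => if x = -b then b :: flipFirst b k s else x :: flipFirst b (k + 1) s

theorem isFlip_flipFirst (b : ℤˣ) (k : ℕ) (s : List ℤˣ) : IsFlip b k s (flipFirst b k s) := by
  have hb : b ≠ -b := by rcases Int.units_eq_one_or b with rfl | rfl <;> decide
  induction s generalizing k with
  | nil => cases k <;> simp [IsFlip, flipFirst]
  | cons x s ih =>
    cases k with
    | zero => exact ⟨List.forall₂_same.2 fun _ _ => Or.inl rfl, by simp [flipFirst]⟩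
    | succ k =>
      by_cases hx : x = -b
      · obtain ⟨h1, h2⟩ := ih k
        refine ⟨?_, ?_⟩
        · simp only [flipFirst, hx, if_true]
          exact List.Forall₂.cons (Or.inr ⟨rfl, rfl⟩) h1
        · simp only [flipFirst, hx, if_true, List.count_cons_self, h2,
            List.count_cons_of_ne hb.symm]
          omega
      · obtain ⟨h1, h2⟩ := ih (k + 1)
        refine ⟨?_, ?_⟩
        · simp only [flipFirst, hx, if_false]
          exact List.Forall₂.cons (Or.inl rfl) h1
        · simp only [flipFirst, hx, if_false, List.count_cons, h2]
          simp only [beq_iff_eq, hx, if_false]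
          omega

/-- There is a flip rule: flip the first admissible entries. -/
instance (δ : ℝ) (rd : ℝ → ℕ) : Nonempty (FlipRule δ rd) := by
  have h : ∀ s₁ s₂ : List ℤˣ, ∃ s₂', IsUpdate δ rd s₁ s₂ s₂' := by
    intro s₁ s₂
    rcases lt_trichotomy (height s₁) 0 with h | h | h
    · exact ⟨_, fun h' => absurd h' h.not_gt, fun _ => isFlip_flipFirst _ _ s₂,
        fun h' => absurd h' h.ne⟩
    · exact ⟨s₂, fun h' => absurd h h'.ne', fun h' => absurd h h'.ne, fun _ => rfl⟩
    · exact ⟨_, fun _ => isFlip_flipFirst _ _ s₂, fun h' => absurd h' h.not_gt,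
        fun h' => absurd h' h.ne'⟩
  choose f hf using h
  refine ⟨⟨fun s₁ s₂ => PMF.pure (f s₁ s₂), fun s₁ s₂ s₂' hs => ?_⟩⟩
  rw [PMF.support_pure, Set.mem_singleton_iff] at hs
  exact hs ▸ hf s₁ s₂

/-!
The height of `s₁ s₂'` depends only on the heights `x`, `y` of `s₁`, `s₂` and on their length `n`: it
is `x + y ± 2r`, with `r` the rounding of `δ|x|`, except that the second half cannot leave
`[-n, n]` (`IsUpdate.height_append_eq`). So the choice of the flipped entries is irrelevant, and the
law of the height evolves by `heightStep`, applied to two independent copies. This law is symmetric.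
It is represented by its expectation functional `heightMean`, and `prob_height_mem` makes the
connection with the random walk.

*Variance.* By symmetry the variance grows in each step by a factor of about `2 (1 + 2δ + 2δ²)`. The
rounding changes this by a relative error `O(1 / √n)`. If flips are impossible, then `|y|` is close
to `n`, so a multiple of `r y² / n` exceeds the loss, and its expectation is small by independence
of `x` and `y`: no tail estimates are needed
(`le_heightStep_sq`). The errors are summable over the steps, and the variance lies between
`T (1 + δ) ^ i / 2` and `2 T (1 + 3δ) ^ i` (`heightMean_growth`). The number `i` of steps is
comparable to `log T`, which yields the powers `T ^ (c δ)` (`sqMoment_heightMean_bounds`). The upper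
bound on the height is Chebyshev's inequality.

*Anticoncentration.* The fourth moment stays at most four times the square of the variance, hence the
characteristic function at a frequency `s / σ` with `1/2 ≤ s ≤ 1` is bounded away from `1`. Since
`|h - (x + y)| ≤ 2δ|x| + 2` for the new height `h`, each step squares the characteristic function up
to a small error (`abs_charFn_pairMean_sub_le`), so after five steps it is at most `1/20`. Testing
with `((1 + 2 cos u) / 3) ^ 2`, a trigonometric polynomial of mean `1/3`, bounds the probability that
the height is a small multiple of `σ` by `2/5` (`heightMean_small_le`). Together with a failure
probability `1/16` from Chebyshev's inequality this stays below `1/2`.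
-/

/-! ### Symmetric means on the integers -/

/-- A symmetric averaging functional concentrated on `[-n, n]`: the expectation of functions of an
integer random variable `X` with `|X| ≤ n` such that `X` and `-X` have the same law. Working with
the functional instead of a measure makes integrability questions disappear. -/
structure IsSymmMean (n : ℕ) (E : (ℤ → ℝ) →ₗ[ℝ] ℝ) : Prop where
  one : E (fun _ => 1) = 1
  mono : ∀ f g : ℤ → ℝ, (∀ x : ℤ, |x| ≤ n → f x ≤ g x) → E f ≤ E g
  symm : ∀ f : ℤ → ℝ, E (fun x => f (-x)) = E f

theorem mean_add (E : (ℤ → ℝ) →ₗ[ℝ] ℝ) (f g : ℤ → ℝ) :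
    E (fun x => f x + g x) = E f + E g := map_add E f g

theorem mean_mul (E : (ℤ → ℝ) →ₗ[ℝ] ℝ) (c : ℝ) (f : ℤ → ℝ) :
    E (fun x => c * f x) = c * E f := map_smul E c f

/-- The first absolute moment. -/
def absMoment (E : (ℤ → ℝ) →ₗ[ℝ] ℝ) : ℝ := E fun x => |(x : ℝ)|

/-- The second moment. -/
def sqMoment (E : (ℤ → ℝ) →ₗ[ℝ] ℝ) : ℝ := E fun x => (x : ℝ) ^ 2

/-- The fourth moment. -/
def fourthMoment (E : (ℤ → ℝ) →ₗ[ℝ] ℝ) : ℝ := E fun x => (x : ℝ) ^ 4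

/-- The characteristic function, which is real by symmetry. -/
noncomputable def charFn (E : (ℤ → ℝ) →ₗ[ℝ] ℝ) (t : ℝ) : ℝ := E fun x => Real.cos (t * x)

theorem cos_le_quartic (u : ℝ) : Real.cos u ≤ 1 - u ^ 2 / 2 + u ^ 4 / 24 := by
  wlog hu : 0 < u generalizing u
  · rcases (not_lt.1 hu).eq_or_lt with rfl | hu
    · simp
    · have := this (-u) (by linarith)
      rwa [Real.cos_neg, neg_sq, Even.neg_pow (by decide)] at this
  rcases le_total (u ^ 2) 24 with h | h
  · have h1 : u / 2 - (u / 2) ^ 3 / 6 ≤ Real.sin (u / 2) :=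
      (Real.sin_gt_sub_cube (by linarith)).le
    have h0 : 0 ≤ u / 2 - (u / 2) ^ 3 / 6 := by nlinarith
    have h2 := pow_le_pow_left₀ h0 h1 2
    have h3 := Real.cos_two_mul (u / 2)
    rw [mul_div_cancel₀ _ two_ne_zero, Real.cos_sq'] at h3
    rw [h3]
    have : 0 ≤ u ^ 6 := by positivity
    nlinarith
  · nlinarith [Real.cos_le_one u]

namespace IsSymmMean

variable {n : ℕ} {E : (ℤ → ℝ) →ₗ[ℝ] ℝ}

theorem const (h : IsSymmMean n E) (c : ℝ) : E (fun _ => c) = c := by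
  have := mean_mul E c fun _ => 1
  simpa [h.one] using this

/-- By symmetry a function may be replaced by its even part. -/
theorem mono_even (h : IsSymmMean n E) {f g : ℤ → ℝ}
    (hfg : ∀ x : ℤ, |x| ≤ n → f x + f (-x) ≤ g x + g (-x)) : E f ≤ E g := by
  have h1 := h.mono (fun x => f x + f (-x)) (fun x => g x + g (-x)) hfg
  rw [mean_add, mean_add, h.symm, h.symm] at h1
  linarith

theorem polynomial (h : IsSymmMean n E) (a b c d : ℝ) :
    E (fun x => a * (x : ℝ) ^ 4 + b * (x : ℝ) ^ 2 + c * |(x : ℝ)| + d) =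
      a * fourthMoment E + b * sqMoment E + c * absMoment E + d := by
  rw [mean_add, mean_add, mean_add, mean_mul, mean_mul, mean_mul, h.const]
  rfl

theorem le_polynomial (h : IsSymmMean n E) (a b c d : ℝ) {f : ℤ → ℝ}
    (hf : ∀ x : ℤ, |x| ≤ n →
      f x + f (-x) ≤ 2 * (a * (x : ℝ) ^ 4 + b * (x : ℝ) ^ 2 + c * |(x : ℝ)| + d)) :
    E f ≤ a * fourthMoment E + b * sqMoment E + c * absMoment E + d := by
  rw [← h.polynomial]
  refine h.mono_even fun x hx => (hf x hx).trans (le_of_eq ?_)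
  push_cast
  rw [abs_neg]
  ring

theorem polynomial_le (h : IsSymmMean n E) (a b c d : ℝ) {f : ℤ → ℝ}
    (hf : ∀ x : ℤ, |x| ≤ n →
      2 * (a * (x : ℝ) ^ 4 + b * (x : ℝ) ^ 2 + c * |(x : ℝ)| + d) ≤ f x + f (-x)) :
    a * fourthMoment E + b * sqMoment E + c * absMoment E + d ≤ E f := by
  rw [← h.polynomial]
  refine h.mono_even fun x hx => (le_of_eq ?_).trans (hf x hx)
  push_cast
  rw [abs_neg]
  ring

theorem absMoment_nonneg (h : IsSymmMean n E) : 0 ≤ absMoment E := by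
  have := h.mono (fun _ => 0) (fun x => |(x : ℝ)|) fun x _ => abs_nonneg _
  rwa [h.const] at this

theorem absMoment_sq_le (h : IsSymmMean n E) : absMoment E ^ 2 ≤ sqMoment E := by
  have h1 := h.mono (fun _ => 0)
    (fun x => 0 * (x : ℝ) ^ 4 + 1 * (x : ℝ) ^ 2 + (-2 * absMoment E) * |(x : ℝ)|
      + absMoment E ^ 2) fun x _ => by
      nlinarith [sq_nonneg (|(x : ℝ)| - absMoment E), sq_abs (x : ℝ)]
  rw [h.const, h.polynomial] at h1
  nlinarith

theorem charFn_le (h : IsSymmMean n E) (t : ℝ) :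
    charFn E t ≤ 1 - t ^ 2 / 2 * sqMoment E + t ^ 4 / 24 * fourthMoment E := by
  have h1 := h.le_polynomial (t ^ 4 / 24) (-(t ^ 2 / 2)) 0 1 (f := fun x => Real.cos (t * x)) ?_
  · unfold charFn; linarith
  intro x _
  have h2 := cos_le_quartic (t * x)
  push_cast
  rw [mul_neg, Real.cos_neg]
  nlinarith

theorem le_charFn (h : IsSymmMean n E) (t : ℝ) : 1 - t ^ 2 / 2 * sqMoment E ≤ charFn E t := by
  have h1 := h.polynomial_le 0 (-(t ^ 2 / 2)) 0 1 (f := fun x => Real.cos (t * x)) ?_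
  · unfold charFn; linarith
  intro x _
  have := Real.one_sub_sq_div_two_le_cos (x := t * x)
  push_cast
  rw [mul_neg, Real.cos_neg]
  nlinarith

end IsSymmMean

/-- The law of `G X Y` for independent `X`, `Y` with the law given by `E`. -/
def pairMean (G : ℤ → ℤ → ℤ) (E : (ℤ → ℝ) →ₗ[ℝ] ℝ) : (ℤ → ℝ) →ₗ[ℝ] ℝ where
  toFun f := E fun x => E fun y => f (G x y)
  map_add' f g := by
    simp only [Pi.add_apply]
    rw [← mean_add]
    congr 1
    funext x
    exact mean_add E _ _
  map_smul' c f := by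
    simp only [Pi.smul_apply, smul_eq_mul, RingHom.id_apply]
    rw [← mean_mul]
    congr 1
    funext x
    exact mean_mul E _ _

theorem pairMean_apply (G : ℤ → ℤ → ℤ) (E : (ℤ → ℝ) →ₗ[ℝ] ℝ) (f : ℤ → ℝ) :
    pairMean G E f = E fun x => E fun y => f (G x y) := rfl

theorem IsSymmMean.pairMean {n : ℕ} {E : (ℤ → ℝ) →ₗ[ℝ] ℝ} (h : IsSymmMean n E) {G : ℤ → ℤ → ℤ}
    (hG : ∀ x y : ℤ, |x| ≤ n → |y| ≤ n → |G x y| ≤ 2 * n) (hodd : ∀ x y, G (-x) (-y) = -G x y) :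
    IsSymmMean (2 * n) (pairMean G E) where
  one := by rw [pairMean_apply, h.one, h.one]
  mono f g hfg := h.mono _ _ fun x hx => h.mono _ _ fun y hy =>
    hfg _ (by have := hG x y hx hy; push_cast; exact this)
  symm f := by
    simp only [pairMean_apply]
    rw [← h.symm]
    congr 1
    funext x
    rw [← h.symm]
    congr 1
    funext y
    rw [hodd, neg_neg]

/-! ### The evolution of the height in one doubling step -/

/-- The height of `s₁ s₂'` as a function of the heights `x` of `s₁` and `y` of `s₂`, where both have
length `n`. -/
noncomputable def heightStep (δ : ℝ) (rd : ℝ → ℕ) (n : ℕ) (x y : ℤ) : ℤ :=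
  if 0 < x then x + min (y + 2 * rd (δ * |(x : ℝ)|)) n
  else if x < 0 then x + max (y - 2 * rd (δ * |(x : ℝ)|)) (-n)
  else y

section heightStep

variable {δ : ℝ} {rd : ℝ → ℕ} {n : ℕ}

theorem heightStep_neg (x y : ℤ) : heightStep δ rd n (-x) (-y) = -heightStep δ rd n x y := by
  unfold heightStep
  push_cast
  rw [abs_neg]
  generalize rd _ = r
  split_ifs <;> omega

theorem abs_heightStep_le (x y : ℤ) (hx : |x| ≤ n) (hy : |y| ≤ n) :
    |heightStep δ rd n x y| ≤ 2 * n := by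
  rw [abs_le] at *
  unfold heightStep
  generalize rd _ = r
  split_ifs <;> omega

theorem heightStep_of_pos {x : ℤ} (hx : 0 < x) (y : ℤ) :
    (heightStep δ rd n x y : ℝ) = x + min (y + 2 * (rd (δ * |(x : ℝ)|) : ℝ)) n := by
  simp [heightStep, hx]

/-- Statements that are invariant under `(x, y) ↦ (-x, -y)` need to be checked for `0 ≤ x` only. -/
theorem heightStep_induction {P : ℤ → ℤ → ℤ → Prop}
    (hneg : ∀ x y z, P x y z → P (-x) (-y) (-z)) (h0 : ∀ y, P 0 y y)
    (hpos : ∀ x y, 0 < x → P x y (heightStep δ rd n x y)) (x y : ℤ) :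
    P x y (heightStep δ rd n x y) := by
  rcases lt_trichotomy x 0 with hx | rfl | hx
  · have := hneg _ _ _ (hpos (-x) (-y) (by omega))
    rwa [heightStep_neg, neg_neg, neg_neg, neg_neg] at this
  · simpa [heightStep] using h0 y
  · exact hpos x y hx

/-- The height deviates from the plain sum of the heights by at most about `2δ|x|`, whatever the
rounding and however many of the prescribed flips are impossible. -/
theorem abs_heightStep_sub_le (hδ : 0 ≤ δ) (hrd : IsRounding rd) (x y : ℤ) (hy : |y| ≤ n) :
    |(heightStep δ rd n x y : ℝ) - (x + y)| ≤ 2 * δ * |(x : ℝ)| + 2 := by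
  revert hy
  refine heightStep_induction
    (P := fun x y z => |y| ≤ n → |(z : ℝ) - (x + y)| ≤ 2 * δ * |(x : ℝ)| + 2) ?_ ?_ ?_ x y
  · intro x y z h hy
    rw [abs_neg] at hy
    rw [← abs_neg]
    convert h hy using 2
    · push_cast; ring
    · push_cast; rw [abs_neg]
  · simp
  · intro x y hx hy
    have hy' : (y : ℝ) ≤ n := by exact_mod_cast (abs_le.1 hy).2
    have h1 := abs_lt.1 (hrd (δ * |(x : ℝ)|) (by positivity))
    rw [heightStep_of_pos hx, abs_le]
    have h2 : (0 : ℝ) ≤ rd (δ * |(x : ℝ)|) := by positivity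
    have h3 : 0 ≤ δ * |(x : ℝ)| := by positivity
    rcases le_total ((y : ℝ) + 2 * (rd (δ * |(x : ℝ)|) : ℝ)) n with h | h
    · rw [min_eq_left h]
      constructor <;> linarith
    · rw [min_eq_right h]
      constructor <;> linarith

/-- Impossible flips only bring the height closer to zero than the idealized step `y ↦ z + y`. -/
theorem exists_abs_heightStep_le (hδ : 0 ≤ δ) (hrd : IsRounding rd) (x : ℤ) :
    ∃ z : ℝ, |z| ≤ (1 + 2 * δ) * |(x : ℝ)| + 2 ∧
      ∀ y : ℤ, |(heightStep δ rd n x y : ℝ)| ≤ |z + y| := by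
  have hpos : ∀ x : ℤ, 0 < x → ∃ z : ℝ, |z| ≤ (1 + 2 * δ) * |(x : ℝ)| + 2 ∧
      ∀ y : ℤ, |(heightStep δ rd n x y : ℝ)| ≤ |z + y| := by
    intro x hx
    have hx' : (0 : ℝ) < x := by exact_mod_cast hx
    have h1 := abs_lt.1 (hrd (δ * |(x : ℝ)|) (by positivity))
    have h2 : (0 : ℝ) ≤ rd (δ * |(x : ℝ)|) := by positivity
    refine ⟨x + 2 * (rd (δ * |(x : ℝ)|) : ℝ), ?_, fun y => ?_⟩
    · rw [abs_of_nonneg (by linarith)]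
      have := abs_of_pos hx'
      linarith
    · rw [heightStep_of_pos hx]
      rcases le_total ((y : ℝ) + 2 * (rd (δ * |(x : ℝ)|) : ℝ)) n with h | h
      · rw [min_eq_left h]
        exact le_of_eq (by ring_nf)
      · rw [min_eq_right h]
        have hn : (0 : ℝ) ≤ n := n.cast_nonneg
        rw [abs_of_nonneg (by linarith), abs_of_nonneg (by linarith)]
        linarith
  rcases lt_trichotomy x 0 with hx | rfl | hx
  · obtain ⟨z, hz, h⟩ := hpos (-x) (by omega)
    refine ⟨-z, ?_, fun y => ?_⟩
    · simpa using hz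
    · have := h (-y)
      rw [heightStep_neg] at this
      push_cast at this
      rw [abs_neg] at this
      rwa [← abs_neg (-z + (y : ℝ)), neg_add, neg_neg]
  · exact ⟨0, by simp, fun y => by simp [heightStep]⟩
  · exact hpos x hx

/-- The real inequality behind `le_heightStep_sq`. If all flips are possible, the left side is
`2 * ((x + 2 * r) ^ 2 + b ^ 2)`; otherwise `b` is close to `n` and the error term takes over. -/
theorem le_sq_add_sq_min {x b r N : ℝ} (hN : 1000 ≤ N) (hx : 0 < x) (hxN : x ≤ N) (hb : 0 ≤ b)
    (hbN : b ≤ N) (hr : 0 ≤ r) (hrN : 100 * r ≤ N) :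
    2 * x ^ 2 + 2 * b ^ 2 + 8 * x * r - 24 * r * (b ^ 2 / N) ≤
      (x + min (b + 2 * r) N) ^ 2 + (x + min (-b + 2 * r) N) ^ 2 := by
  rw [min_eq_left (by linarith : -b + 2 * r ≤ N)]
  rcases le_total (b + 2 * r) N with h | h
  · rw [min_eq_left h]
    have : 0 ≤ 24 * r * (b ^ 2 / N) := by positivity
    nlinarith [sq_nonneg r]
  · rw [min_eq_right h]
    have h1 : 0.9 * b ≤ b ^ 2 / N := by
      rw [le_div_iff₀ (by linarith)]
      nlinarith
    have h2 : (x + b) ^ 2 ≤ (x + N) ^ 2 := by gcongr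
    have h3 : 0 ≤ r * (12 * (b ^ 2 / N) - 2 * x - 2 * b) :=
      mul_nonneg hr (by linarith)
    nlinarith [sq_nonneg r]

/-- The gain of the second moment, before averaging over `x` and `|y|`. -/
theorem le_heightStep_sq (hδ : 0 ≤ δ) (hδ' : δ ≤ 1 / 10000) (hrd : IsRounding rd)
    (hn : 1000000 ≤ n) (x y : ℤ) (hx : |x| ≤ n) (hy : |y| ≤ n) :
    2 * (x : ℝ) ^ 2 + 2 * (y : ℝ) ^ 2 + 8 * δ * (x : ℝ) ^ 2 - 8 * |(x : ℝ)|
        - 24 * (δ * |(x : ℝ)| + 1) * ((y : ℝ) ^ 2 / n) ≤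
      (heightStep δ rd n x y : ℝ) ^ 2 + (heightStep δ rd n x (-y) : ℝ) ^ 2 := by
  wlog hx0 : 0 ≤ x generalizing x
  · have := this (-x) (by rwa [abs_neg]) (by omega)
    have h1 := heightStep_neg (δ := δ) (rd := rd) (n := n) x y
    have h2 := heightStep_neg (δ := δ) (rd := rd) (n := n) x (-y)
    rw [neg_neg] at h2
    rw [h1, h2] at this
    push_cast at this
    rw [abs_neg, neg_sq, neg_sq, neg_sq] at this
    linarith
  wlog hy0 : 0 ≤ y generalizing y
  · have := this (-y) (by rwa [abs_neg]) (by omega)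
    rw [neg_neg] at this
    push_cast at this
    rw [neg_sq] at this
    linarith
  have hN : (1000000 : ℝ) ≤ n := by exact_mod_cast hn
  rcases hx0.eq_or_lt with rfl | hx0
  · simp only [heightStep, lt_irrefl, if_false]
    push_cast
    have : (0 : ℝ) ≤ (y : ℝ) ^ 2 / n := by positivity
    simp only [abs_zero]
    nlinarith
  rw [heightStep_of_pos hx0, heightStep_of_pos hx0]
  have hx1 : (0 : ℝ) < x := by exact_mod_cast hx0
  have hy1 : (0 : ℝ) ≤ y := by exact_mod_cast hy0
  have hx2 : (x : ℝ) ≤ n := by exact_mod_cast (abs_le.1 hx).2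
  have hy2 : (y : ℝ) ≤ n := by exact_mod_cast (abs_le.1 hy).2
  have h1 := abs_lt.1 (hrd (δ * |(x : ℝ)|) (by positivity))
  have h2 : (0 : ℝ) ≤ rd (δ * |(x : ℝ)|) := by positivity
  rw [abs_of_pos hx1] at *
  generalize (rd (δ * (x : ℝ)) : ℝ) = r at *
  have h3 : δ * x ≤ 1 / 10000 * n := by gcongr
  have h4 := le_sq_add_sq_min (by linarith) hx1 hx2 hy1 hy2 h2 (by linarith)
  push_cast
  have h5 : (0 : ℝ) ≤ (y : ℝ) ^ 2 / n := by positivity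
  have h6 : r * ((y : ℝ) ^ 2 / n) ≤ (δ * x + 1) * ((y : ℝ) ^ 2 / n) := by gcongr; linarith
  have h7 : (δ * x - 1) * x ≤ r * x := by gcongr; linarith
  nlinarith

end heightStep

/-! ### Moments and characteristic function after one doubling step -/

section oneStep

variable {δ : ℝ} {rd : ℝ → ℕ} {n : ℕ} {E : (ℤ → ℝ) →ₗ[ℝ] ℝ}

theorem sqMoment_pairMean_le (h : IsSymmMean n E) (hδ : 0 ≤ δ) (hrd : IsRounding rd) :
    sqMoment (pairMean (heightStep δ rd n) E) ≤
      ((1 + 2 * δ) ^ 2 + 1) * sqMoment E + 4 * (1 + 2 * δ) * absMoment E + 4 := by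
  have hin : ∀ x : ℤ, (E fun y => (heightStep δ rd n x y : ℝ) ^ 2) ≤
      sqMoment E + ((1 + 2 * δ) * |(x : ℝ)| + 2) ^ 2 := by
    intro x
    obtain ⟨z, hz, hzy⟩ := exists_abs_heightStep_le (n := n) hδ hrd x
    have h1 := h.le_polynomial 0 1 0 (z ^ 2)
      (f := fun y => (heightStep δ rd n x y : ℝ) ^ 2) fun y _ => by
        have h2 := sq_le_sq.2 (hzy y)
        have h3 := sq_le_sq.2 (hzy (-y))
        push_cast at h3
        linarith
    have h2 : z ^ 2 ≤ ((1 + 2 * δ) * |(x : ℝ)| + 2) ^ 2 := by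
      rw [← sq_abs]; gcongr
    linarith
  have h1 := h.le_polynomial 0 ((1 + 2 * δ) ^ 2) (4 * (1 + 2 * δ)) (4 + sqMoment E)
    (f := fun x => E fun y => (heightStep δ rd n x y : ℝ) ^ 2) fun x _ => by
      have h2 := hin x
      have h3 := hin (-x)
      push_cast at h3
      rw [abs_neg] at h3
      have h4 := sq_abs (x : ℝ)
      rw [← h4]
      linarith
  have h2 : sqMoment (pairMean (heightStep δ rd n) E) =
    E fun x => E fun y => (heightStep δ rd n x y : ℝ) ^ 2 := rfl
  linarith

theorem le_sqMoment_pairMean (h : IsSymmMean n E) (hδ : 0 ≤ δ) (hδ' : δ ≤ 1 / 10000)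
    (hrd : IsRounding rd) (hn : 1000000 ≤ n) :
    (2 + 4 * δ) * sqMoment E - 4 * absMoment E
        - 12 * (δ * absMoment E + 1) * (sqMoment E / n) ≤
      sqMoment (pairMean (heightStep δ rd n) E) := by
  have hin : ∀ x : ℤ, |x| ≤ n →
      (1 + 4 * δ) * (x : ℝ) ^ 2 - 4 * |(x : ℝ)| + sqMoment E
        - 12 * (δ * |(x : ℝ)| + 1) * (sqMoment E / n) ≤
      E fun y => (heightStep δ rd n x y : ℝ) ^ 2 := by
    intro x hx
    have h1 := h.polynomial_le 0 (1 - 12 * (δ * |(x : ℝ)| + 1) / n) 0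
      ((1 + 4 * δ) * (x : ℝ) ^ 2 - 4 * |(x : ℝ)|)
      (f := fun y => (heightStep δ rd n x y : ℝ) ^ 2) fun y hy => by
        have h2 := le_heightStep_sq hδ hδ' hrd hn x y hx hy
        refine le_trans (le_of_eq ?_) h2
        ring
    refine le_trans (le_of_eq ?_) h1
    ring
  have h1 := h.polynomial_le 0 (1 + 4 * δ) (-4 - 12 * δ * (sqMoment E / n))
    (sqMoment E - 12 * (sqMoment E / n))
    (f := fun x => E fun y => (heightStep δ rd n x y : ℝ) ^ 2) fun x hx => by
      have h2 := hin x hx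
      have h3 := hin (-x) (by rwa [abs_neg])
      push_cast at h3
      rw [abs_neg] at h3
      linarith
  have h2 : sqMoment (pairMean (heightStep δ rd n) E) =
    E fun x => E fun y => (heightStep δ rd n x y : ℝ) ^ 2 := rfl
  linarith

theorem fourthMoment_pairMean_le (h : IsSymmMean n E) (hδ : 0 ≤ δ) (hδ' : δ ≤ 1 / 10000)
    (hrd : IsRounding rd) :
    fourthMoment (pairMean (heightStep δ rd n) E) ≤
      2.03 * fourthMoment E + 6 * sqMoment E * (1.01 * sqMoment E + 500) + 30000000 := by
  have ha : 0 ≤ sqMoment E := (sq_nonneg _).trans h.absMoment_sq_le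
  have hin : ∀ x : ℤ, (E fun y => (heightStep δ rd n x y : ℝ) ^ 4) ≤
      fourthMoment E + 6 * sqMoment E * (1.01 * (x : ℝ) ^ 2 + 500)
        + (1.03 * (x : ℝ) ^ 4 + 30000000) := by
    intro x
    obtain ⟨z, hz, hzy⟩ := exists_abs_heightStep_le (n := n) hδ hrd x
    have h1 := h.le_polynomial 1 (6 * z ^ 2) 0 (z ^ 4)
      (f := fun y => (heightStep δ rd n x y : ℝ) ^ 4) fun y _ => by
        have h2 := pow_le_pow_left₀ (abs_nonneg _) (hzy y) 4
        have h3 := pow_le_pow_left₀ (abs_nonneg _) (hzy (-y)) 4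
        rw [Even.pow_abs (by decide), Even.pow_abs (by decide)] at h2 h3
        push_cast at h3
        linarith
    have hx := abs_nonneg (x : ℝ)
    have h2 : z ^ 2 ≤ 1.01 * (x : ℝ) ^ 2 + 500 := by
      have h3 : |z| ≤ 1.0002 * |(x : ℝ)| + 2 := by nlinarith
      have h4 := pow_le_pow_left₀ (abs_nonneg _) h3 2
      rw [sq_abs] at h4
      nlinarith [sq_abs (x : ℝ), sq_nonneg (|(x : ℝ)| - 200)]
    have h3 : z ^ 4 ≤ 1.03 * (x : ℝ) ^ 4 + 30000000 := by
      have h4 := pow_le_pow_left₀ (sq_nonneg z) h2 2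
      nlinarith [sq_nonneg ((x : ℝ) ^ 2 - 51000)]
    have h4 : 6 * z ^ 2 * sqMoment E ≤ 6 * (1.01 * (x : ℝ) ^ 2 + 500) * sqMoment E := by gcongr
    linarith
  have h1 := h.le_polynomial 1.03 (6 * sqMoment E * 1.01) 0
    (fourthMoment E + 6 * sqMoment E * 500 + 30000000)
    (f := fun x => E fun y => (heightStep δ rd n x y : ℝ) ^ 4) fun x _ => by
      have h2 := hin x
      have h3 := hin (-x)
      push_cast at h3
      rw [neg_sq, Even.neg_pow (by decide : Even 4)] at h3
      linarith
  have h2 : fourthMoment (pairMean (heightStep δ rd n) E) =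
    E fun x => E fun y => (heightStep δ rd n x y : ℝ) ^ 4 := rfl
  linarith

/-- The height after the step is a sum of two independent copies up to an error controlled by
`abs_heightStep_sub_le`, so the characteristic function is almost squared. -/
theorem abs_charFn_pairMean_sub_le (h : IsSymmMean n E) (hδ : 0 ≤ δ) (hrd : IsRounding rd) {t : ℝ}
    (ht : 0 ≤ t) :
    |charFn (pairMean (heightStep δ rd n) E) t - charFn E t ^ 2| ≤
      t * (2 * δ * absMoment E + 2) := by
  have hsq : ∀ x : ℤ, (E fun y => Real.cos (t * (x + y))) = charFn E t * Real.cos (t * x) := by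
    intro x
    rw [mul_comm (charFn E t)]
    unfold charFn
    rw [← mean_mul]
    refine le_antisymm (h.mono_even fun y _ => le_of_eq ?_) (h.mono_even fun y _ => le_of_eq ?_)
    all_goals
      push_cast
      simp only [mul_add, mul_neg, Real.cos_add, Real.cos_neg, Real.sin_neg]
      ring
  have hclose : ∀ x y : ℤ, |y| ≤ n →
      |Real.cos (t * heightStep δ rd n x y) - Real.cos (t * (x + y))| ≤
        t * (2 * δ * |(x : ℝ)| + 2) := by
    intro x y hy
    refine (Real.abs_cos_sub_cos_le _ _).trans ?_
    rw [← mul_sub, abs_mul, abs_of_nonneg ht]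
    gcongr
    exact abs_heightStep_sub_le hδ hrd x y hy
  have hin : ∀ x : ℤ, |(E fun y => Real.cos (t * heightStep δ rd n x y))
      - charFn E t * Real.cos (t * x)| ≤ t * (2 * δ * |(x : ℝ)| + 2) := by
    intro x
    rw [← hsq, abs_le]
    have h1 := h.mono (fun y => Real.cos (t * heightStep δ rd n x y))
      (fun y => Real.cos (t * (x + y)) + t * (2 * δ * |(x : ℝ)| + 2)) fun y hy => by
        linarith [(abs_le.1 (hclose x y hy)).2]
    have h2 := h.mono (fun y => Real.cos (t * (x + y)))
      (fun y => Real.cos (t * heightStep δ rd n x y) + t * (2 * δ * |(x : ℝ)| + 2)) fun y hy => by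
        linarith [(abs_le.1 (hclose x y hy)).1]
    rw [mean_add, h.const] at h1 h2
    constructor <;> linarith
  have h0 : charFn (pairMean (heightStep δ rd n) E) t =
    E fun x => E fun y => Real.cos (t * heightStep δ rd n x y) := rfl
  have h3 := h.polynomial 0 0 (t * (2 * δ)) (t * 2)
  have h4 := mean_mul E (charFn E t) fun x => Real.cos (t * x)
  have h5 : (E fun x => Real.cos (t * x)) = charFn E t := rfl
  have h1 := h.mono (fun x => E fun y => Real.cos (t * heightStep δ rd n x y))
    (fun x => charFn E t * Real.cos (t * x)
      + (0 * (x : ℝ) ^ 4 + 0 * (x : ℝ) ^ 2 + t * (2 * δ) * |(x : ℝ)| + t * 2)) fun x _ => by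
      linarith [(abs_le.1 (hin x)).2]
  have h2 := h.mono (fun x => charFn E t * Real.cos (t * x))
    (fun x => (E fun y => Real.cos (t * heightStep δ rd n x y))
      + (0 * (x : ℝ) ^ 4 + 0 * (x : ℝ) ^ 2 + t * (2 * δ) * |(x : ℝ)| + t * 2)) fun x _ => by
      linarith [(abs_le.1 (hin x)).1]
  rw [mean_add, h3, h4, h5] at h1
  rw [mean_add, h3, h4, h5] at h2
  rw [h0, abs_le]
  constructor <;> nlinarith

/-- Bounds that persist: the variance is between linear and (a small multiple of) quadratic in the
length, and the fourth moment is comparable to that of a Gaussian. -/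
structure IsTame (n : ℕ) (E : (ℤ → ℝ) →ₗ[ℝ] ℝ) : Prop where
  le_sqMoment : (n : ℝ) / 2 ≤ sqMoment E
  sqMoment_le : sqMoment E ≤ (n : ℝ) ^ 2 / 1000000
  fourthMoment_le : fourthMoment E ≤ 4 * sqMoment E ^ 2

variable {y : ℝ}

/-- Here and below, `y` is any number with `1 / √n ≤ y`; it measures the relative error caused by the
rounding. -/
theorem absMoment_le_of_isTame (h : IsSymmMean n E) (ht : IsTame n E) (hy : 0 ≤ y)
    (hny : 1 ≤ n * y ^ 2) : absMoment E ≤ 1.5 * sqMoment E * y := by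
  have ha := ht.le_sqMoment
  have h0 : (0 : ℝ) ≤ n := n.cast_nonneg
  have ha0 : 0 ≤ sqMoment E := by linarith
  refine le_of_sq_le_sq ?_ (by positivity)
  have h1 := h.absMoment_sq_le
  have h2 : sqMoment E * 1 ≤ sqMoment E * (2 * sqMoment E * y ^ 2) := by
    gcongr
    nlinarith [sq_nonneg y]
  nlinarith [sq_nonneg (sqMoment E * y)]

theorem thousand_le_mul (hn : 1000000 ≤ n) (hy : 0 ≤ y) (hny : 1 ≤ n * y ^ 2) : 1000 ≤ n * y := by
  have hN : (1000000 : ℝ) ≤ n := by exact_mod_cast hn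
  nlinarith [mul_nonneg (by linarith : (0 : ℝ) ≤ n) hy]

theorem sqMoment_pairMean_le_of_isTame (h : IsSymmMean n E) (ht : IsTame n E) (hδ : 0 ≤ δ)
    (hδ' : δ ≤ 1 / 10000) (hrd : IsRounding rd) (hn : 1000000 ≤ n) (hy : 0 ≤ y)
    (hny : 1 ≤ n * y ^ 2) :
    sqMoment (pairMean (heightStep δ rd n) E) ≤ 2 * sqMoment E * ((1 + 3 * δ) * (1 + 4 * y)) := by
  have h1 := sqMoment_pairMean_le h hδ hrd (δ := δ) (rd := rd)
  have h2 := absMoment_le_of_isTame h ht hy hny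
  have h3 := thousand_le_mul hn hy hny
  have ha := ht.le_sqMoment
  set a := sqMoment E
  have h4 : 500 ≤ a * y := by nlinarith
  have ha0 : 0 ≤ a := le_trans (by positivity) ha
  have h5 : 4 * (1 + 2 * δ) * absMoment E ≤ 4 * 1.0002 * (1.5 * a * y) := by
    have := h.absMoment_nonneg
    gcongr
    linarith
  have h6 : δ * (a * y) ≥ 0 := by positivity
  have h7 : δ * a * δ ≤ δ * a * (1 / 10000) := by gcongr
  have h8 : 0 ≤ δ * a := by positivity
  nlinarith

theorem le_sqMoment_pairMean_of_isTame (h : IsSymmMean n E) (ht : IsTame n E) (hδ : 0 ≤ δ)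
    (hδ' : δ ≤ 1 / 10000) (hrd : IsRounding rd) (hn : 1000000 ≤ n) (hy : 0 ≤ y)
    (hny : 1 ≤ n * y ^ 2) :
    2 * sqMoment E * ((1 + δ) * (1 - 4 * y)) ≤ sqMoment (pairMean (heightStep δ rd n) E) := by
  have h1 := le_sqMoment_pairMean h hδ hδ' hrd hn
  have h2 := absMoment_le_of_isTame h ht hy hny
  have h3 := thousand_le_mul hn hy hny
  have hN : (1000000 : ℝ) ≤ n := by exact_mod_cast hn
  have hsq := h.absMoment_sq_le
  have hm := h.absMoment_nonneg
  have ha := ht.le_sqMoment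
  have hb := ht.sqMoment_le
  set a := sqMoment E
  have ha0 : 0 ≤ a := le_trans (by positivity) ha
  have h4 : absMoment E ≤ n / 1000 := by
    refine le_of_sq_le_sq ?_ (by positivity)
    calc _ ≤ _ := hsq.trans hb
      _ = _ := by ring
  have h5 : absMoment E * (a / n) ≤ a / 1000 := by
    calc absMoment E * (a / n) ≤ n / 1000 * (a / n) := by gcongr
      _ = a / 1000 := by field_simp
  have h6 : a / n ≤ a * y / 1000 := by
    rw [div_le_iff₀ (by linarith)]
    nlinarith
  have h7 : δ * (absMoment E * (a / n)) ≤ δ * (a / 1000) := by gcongr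
  have h8 : 0 ≤ δ * (a * y) := by positivity
  have h9 : 0 ≤ δ * a := by positivity
  have h10 : 0 ≤ a * y := by positivity
  nlinarith

theorem sqMoment_pairMean_le_four_mul (h : IsSymmMean n E) (ht : IsTame n E) (hδ : 0 ≤ δ)
    (hδ' : δ ≤ 1 / 10000) (hrd : IsRounding rd) (hn : 1000000 ≤ n) :
    sqMoment (pairMean (heightStep δ rd n) E) ≤ 4 * sqMoment E := by
  have hN : (1000000 : ℝ) ≤ n := by exact_mod_cast hn
  have h1 := sqMoment_pairMean_le_of_isTame (y := 1 / 1000) h ht hδ hδ' hrd hn (by norm_num)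
    (by linarith)
  have ha := ht.le_sqMoment
  have ha0 : 0 ≤ sqMoment E := le_trans (by positivity) ha
  nlinarith

theorem IsTame.pairMean (h : IsSymmMean n E) (ht : IsTame n E) (hδ : 0 ≤ δ)
    (hδ' : δ ≤ 1 / 10000) (hrd : IsRounding rd) (hn : 1000000 ≤ n)
    (hlow : (n : ℝ) ≤ sqMoment (pairMean (heightStep δ rd n) E)) :
    IsTame (2 * n) (pairMean (heightStep δ rd n) E) where
  le_sqMoment := by push_cast; linarith
  sqMoment_le := by
    have h1 := sqMoment_pairMean_le_four_mul h ht hδ hδ' hrd hn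
    have h2 := ht.sqMoment_le
    push_cast
    linarith
  fourthMoment_le := by
    have hN : (1000000 : ℝ) ≤ n := by exact_mod_cast hn
    have h1 := le_sqMoment_pairMean_of_isTame (y := 1 / 1000) h ht hδ hδ' hrd hn (by norm_num)
      (by linarith)
    have ha := ht.le_sqMoment
    have ha0 : 500000 ≤ sqMoment E := by linarith
    have h2 : 1.95 * sqMoment E ≤ sqMoment (_root_.pairMean (heightStep δ rd n) E) := by nlinarith
    have h3 := pow_le_pow_left₀ (by linarith) h2 2
    have h4 := fourthMoment_pairMean_le h hδ hδ' hrd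
    have h5 := ht.fourthMoment_le
    nlinarith

end oneStep

/-! ### The first level: sums of independent signs -/

/-- The expectation of functions of the sum of `l` independent uniform signs. -/
noncomputable def signSumMean : ℕ → (ℤ → ℝ) →ₗ[ℝ] ℝ
  | 0 => LinearMap.proj 0
  | l + 1 => (1 / 2 : ℝ) • ((signSumMean l).comp (LinearMap.funLeft ℝ ℝ (· + 1)) +
      (signSumMean l).comp (LinearMap.funLeft ℝ ℝ (· - 1)))

theorem signSumMean_zero (f : ℤ → ℝ) : signSumMean 0 f = f 0 := rfl

theorem signSumMean_succ (l : ℕ) (f : ℤ → ℝ) :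
    signSumMean (l + 1) f =
      1 / 2 * (signSumMean l (fun x => f (x + 1)) + signSumMean l (fun x => f (x - 1))) := rfl

theorem isSymmMean_signSumMean (l : ℕ) : IsSymmMean l (signSumMean l) := by
  induction l with
  | zero => exact ⟨rfl, fun f g h => h 0 (by simp), fun f => by simp [signSumMean_zero]⟩
  | succ l ih =>
    refine ⟨?_, fun f g h => ?_, fun f => ?_⟩
    · rw [signSumMean_succ, ih.one]; norm_num
    · rw [signSumMean_succ, signSumMean_succ]
      have h1 := ih.mono (fun x => f (x + 1)) (fun x => g (x + 1)) fun x hx => h _ (by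
        rw [abs_le] at *; push_cast; omega)
      have h2 := ih.mono (fun x => f (x - 1)) (fun x => g (x - 1)) fun x hx => h _ (by
        rw [abs_le] at *; push_cast; omega)
      linarith
    · rw [signSumMean_succ, signSumMean_succ, ← ih.symm fun x => f (x + 1),
        ← ih.symm fun x => f (x - 1), add_comm]
      congr 3
      all_goals
        funext x
        congr 1
        ring

theorem sqMoment_signSumMean (l : ℕ) : sqMoment (signSumMean l) = l := by
  induction l with
  | zero => simp [sqMoment, signSumMean_zero]
  | succ l ih =>
    have h := isSymmMean_signSumMean l
    have key : sqMoment (signSumMean (l + 1)) = 1 / 2 *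
      (signSumMean l (fun x => ((x + 1 : ℤ) : ℝ) ^ 2) +
        signSumMean l (fun x => ((x - 1 : ℤ) : ℝ) ^ 2)) := rfl
    rw [key, ← mean_add, ← mean_mul]
    have h1 := h.polynomial 0 1 0 1
    rw [ih] at h1
    push_cast
    rw [show (l : ℝ) + 1 = 0 * fourthMoment (signSumMean l) + 1 * l +
      0 * absMoment (signSumMean l) + 1 by ring, ← h1]
    congr 1
    funext x
    ring

theorem fourthMoment_signSumMean_le (l : ℕ) : fourthMoment (signSumMean l) ≤ 3 * (l : ℝ) ^ 2 := by
  induction l with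
  | zero => simp [fourthMoment, signSumMean_zero]
  | succ l ih =>
    have h := isSymmMean_signSumMean l
    have key : fourthMoment (signSumMean (l + 1)) = 1 / 2 *
      (signSumMean l (fun x => ((x + 1 : ℤ) : ℝ) ^ 4) +
        signSumMean l (fun x => ((x - 1 : ℤ) : ℝ) ^ 4)) := rfl
    rw [key, ← mean_add, ← mean_mul]
    have h1 := h.polynomial 1 6 0 1
    rw [sqMoment_signSumMean] at h1
    have h2 : (signSumMean l fun x => 1 / 2 * (((x + 1 : ℤ) : ℝ) ^ 4 + ((x - 1 : ℤ) : ℝ) ^ 4)) =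
        signSumMean l fun x => 1 * (x : ℝ) ^ 4 + 6 * (x : ℝ) ^ 2 + 0 * |(x : ℝ)| + 1 := by
      congr 1
      funext x
      push_cast
      ring
    rw [h2, h1]
    push_cast
    linarith

/-! ### The height of the fractal random walk -/

/-- The expectation of functions of the height of the fractal random walk of length `2 ^ j * l`. -/
noncomputable def heightMean (δ : ℝ) (rd : ℝ → ℕ) (l : ℕ) : ℕ → (ℤ → ℝ) →ₗ[ℝ] ℝ
  | 0 => signSumMean l
  | j + 1 => pairMean (heightStep δ rd (2 ^ j * l)) (heightMean δ rd l j)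

theorem isSymmMean_heightMean (δ : ℝ) (rd : ℝ → ℕ) (l j : ℕ) :
    IsSymmMean (2 ^ j * l) (heightMean δ rd l j) := by
  induction j with
  | zero => simpa [heightMean] using isSymmMean_signSumMean l
  | succ j ih =>
    have := ih.pairMean (fun x y hx hy => abs_heightStep_le (δ := δ) (rd := rd) x y hx hy)
      heightStep_neg
    rw [pow_succ', mul_assoc]
    exact this

section growth

variable {δ : ℝ} {rd : ℝ → ℕ} {l : ℕ}

/-- The growth of the variance by a factor between `2 * (1 + δ)` and `2 * (1 + 3 * δ)` per step. The
rounding and the impossible flips cost a factor `1 ± O(1 / √(2 ^ j * l))` in step `j`; the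
correction terms `32 * x`, with `x = (3 / 4) ^ j / √l` dominating `1 / √(2 ^ j * l)`, absorb the
product of these factors. -/
theorem heightMean_growth (hδ : 0 ≤ δ) (hδ' : δ ≤ 1 / 10000) (hrd : IsRounding rd)
    (hl : 1000000 ≤ l) (j : ℕ) :
    IsTame (2 ^ j * l) (heightMean δ rd l j) ∧
    2 ^ j * l * (1 + δ) ^ j * (1 / 2 * (1 + 32 * ((3 / 4) ^ j / √l))) ≤
      sqMoment (heightMean δ rd l j) ∧
    sqMoment (heightMean δ rd l j) ≤
      2 ^ j * l * (1 + 3 * δ) ^ j * (2 - 32 * ((3 / 4) ^ j / √l)) := by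
  have hL : (1000000 : ℝ) ≤ l := by exact_mod_cast hl
  have hs : 1000 ≤ √(l : ℝ) := Real.le_sqrt_of_sq_le (by norm_num; linarith)
  have hx : ∀ j : ℕ, 0 < (3 / 4 : ℝ) ^ j / √l ∧ (3 / 4 : ℝ) ^ j / √l ≤ 1 / 1000 := fun j => by
    refine ⟨by positivity, ?_⟩
    gcongr
    exact pow_le_one₀ (by norm_num) (by norm_num)
  induction j with
  | zero =>
    have h0 := hx 0
    simp only [pow_zero, one_mul, mul_one] at *
    simp only [heightMean, sqMoment_signSumMean]
    refine ⟨⟨?_, ?_, ?_⟩, ?_, ?_⟩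
    · rw [sqMoment_signSumMean]; linarith
    · rw [sqMoment_signSumMean]; nlinarith
    · rw [sqMoment_signSumMean]; nlinarith [fourthMoment_signSumMean_le l]
    · nlinarith
    · nlinarith
  | succ j ih =>
    obtain ⟨ht, hlo, hup⟩ := ih
    have h := isSymmMean_heightMean δ rd l j
    have hn : 1000000 ≤ 2 ^ j * l := hl.trans (Nat.le_mul_of_pos_left _ (by positivity))
    obtain ⟨hx0, hx1⟩ := hx j
    have hny : 1 ≤ ((2 ^ j * l : ℕ) : ℝ) * ((3 / 4) ^ j / √l) ^ 2 := by
      rw [div_pow, Real.sq_sqrt (by linarith)]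
      have : ((2 ^ j * l : ℕ) : ℝ) * (((3 / 4) ^ j) ^ 2 / l) = (9 / 8) ^ j := by
        push_cast
        field_simp
        rw [← pow_mul, mul_comm j 2, pow_mul, ← mul_pow]
        norm_num
      rw [this]
      exact one_le_pow₀ (by norm_num)
    have h1 := le_sqMoment_pairMean_of_isTame h ht hδ hδ' hrd hn hx0.le hny
    have h2 := sqMoment_pairMean_le_of_isTame h ht hδ hδ' hrd hn hx0.le hny
    have hN : (0 : ℝ) < 2 ^ j * l := by positivity
    rw [show (3 / 4 : ℝ) ^ (j + 1) / √l = 3 / 4 * ((3 / 4) ^ j / √l) by ring]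
    generalize (3 / 4 : ℝ) ^ j / √l = x at *
    have hlo' : 2 ^ (j + 1) * l * (1 + δ) ^ (j + 1) * (1 / 2 * (1 + 32 * (3 / 4 * x))) ≤
        sqMoment (heightMean δ rd l (j + 1)) := by
      refine le_trans ?_ h1
      calc _ = 2 * (2 ^ j * l * (1 + δ) ^ j * (1 / 2 * (1 + 32 * (3 / 4 * x)))) * (1 + δ) := by
            ring
        _ ≤ 2 * (2 ^ j * l * (1 + δ) ^ j * (1 / 2 * ((1 + 32 * x) * (1 - 4 * x)))) * (1 + δ) := by
            gcongr
            nlinarith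
        _ = 2 * (2 ^ j * l * (1 + δ) ^ j * (1 / 2 * (1 + 32 * x))) * ((1 + δ) * (1 - 4 * x)) := by
            ring
        _ ≤ _ := by
            gcongr
            nlinarith
    refine ⟨?_, hlo', ?_⟩
    · have h3 := IsTame.pairMean h ht hδ hδ' hrd hn (le_trans ?_ hlo')
      · rw [pow_succ', mul_assoc]
        exact h3
      · have h4 : (1 : ℝ) ≤ (1 + δ) ^ (j + 1) := one_le_pow₀ (by linarith)
        push_cast
        have h5 : (2 : ℝ) ^ j * l * 2 * 1 * (1 / 2 * 1) ≤
            2 ^ j * l * 2 * (1 + δ) ^ (j + 1) * (1 / 2 * (1 + 32 * (3 / 4 * x))) := by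
          gcongr
          linarith
        calc _ = (2 : ℝ) ^ j * l * 2 * 1 * (1 / 2 * 1) := by ring
          _ ≤ _ := h5
          _ = _ := by ring
    · refine h2.trans ?_
      calc _ ≤ 2 * (2 ^ j * l * (1 + 3 * δ) ^ j * (2 - 32 * x)) * ((1 + 3 * δ) * (1 + 4 * x)) := by
            gcongr
        _ = 2 * (2 ^ j * l * (1 + 3 * δ) ^ j * ((2 - 32 * x) * (1 + 4 * x))) * (1 + 3 * δ) := by
            ring
        _ ≤ 2 * (2 ^ j * l * (1 + 3 * δ) ^ j * (2 - 32 * (3 / 4 * x))) * (1 + 3 * δ) := by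
            gcongr
            nlinarith
        _ = _ := by ring

end growth

/-! ### Conversion between sequences and heights -/

theorem height_append (s t : List ℤˣ) : height (s ++ t) = height s + height t := by
  simp [height]

theorem height_eq_count (s : List ℤˣ) : height s = s.count 1 - s.count (-1) := by
  induction s with
  | nil => simp [height]
  | cons x s ih =>
    have : height (x :: s) = x + height s := by simp [height]
    rw [this, ih, List.count_cons, List.count_cons]
    rcases Int.units_eq_one_or x with rfl | rfl
    · simp; ring
    · simp; ring

theorem length_eq_count (s : List ℤˣ) : s.length = s.count 1 + s.count (-1) := by
  induction s with
  | nil => simp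
  | cons x s ih =>
    rw [List.length_cons, ih, List.count_cons, List.count_cons]
    rcases Int.units_eq_one_or x with rfl | rfl
    · simp; ring
    · simp; ring

theorem IsFlip.length_eq {b : ℤˣ} {k : ℕ} {s s' : List ℤˣ} (h : IsFlip b k s s') :
    s'.length = s.length := h.1.length_eq.symm

theorem IsUpdate.length_eq {δ : ℝ} {rd : ℝ → ℕ} {s₁ s₂ s₂' : List ℤˣ}
    (h : IsUpdate δ rd s₁ s₂ s₂') : s₂'.length = s₂.length := by
  rcases lt_trichotomy (height s₁) 0 with h0 | h0 | h0
  · exact (h.2.1 h0).length_eq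
  · rw [h.2.2 h0]
  · exact (h.1 h0).length_eq

/-- The height after an update depends on the two heights only, not on the choice of the flipped
entries. -/
theorem IsUpdate.height_append_eq {δ : ℝ} {rd : ℝ → ℕ} {s₁ s₂ s₂' : List ℤˣ}
    (h : IsUpdate δ rd s₁ s₂ s₂') {n : ℕ} (hn : s₂.length = n) :
    height (s₁ ++ s₂') = heightStep δ rd n (height s₁) (height s₂) := by
  have hlen := h.length_eq
  rw [height_append]
  unfold heightStep
  rw [length_eq_count, length_eq_count] at hlen
  rw [length_eq_count] at hn
  have e := height_eq_count s₂
  have e' := height_eq_count s₂'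
  rcases lt_trichotomy (height s₁) 0 with h0 | h0 | h0
  · rw [if_neg (by omega), if_pos h0]
    have := (h.2.1 h0).2
    rw [neg_neg] at this
    generalize rd _ = k at *
    omega
  · rw [if_neg (by omega), if_neg (by omega), h.2.2 h0, h0, zero_add]
  · rw [if_pos h0]
    have := (h.1 h0).2
    generalize rd _ = k at *
    omega

theorem length_of_mem_support_fractalRandomWalk {δ : ℝ} {rd : ℝ → ℕ} (rule : FlipRule δ rd)
    (l i : ℕ) : ∀ s ∈ (fractalRandomWalk rule l i).support, s.length = 2 ^ i * l := by
  induction i with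
  | zero =>
    intro s hs
    simp only [fractalRandomWalk, PMF.support_map, Set.mem_image] at hs
    obtain ⟨ω, -, rfl⟩ := hs
    simp
  | succ i ih =>
    intro s hs
    simp only [fractalRandomWalk, PMF.mem_support_bind_iff, PMF.support_map, Set.mem_image] at hs
    obtain ⟨s₁, h₁, s₂, h₂, s₂', h, rfl⟩ := hs
    rw [List.length_append, (rule.isUpdate _ _ _ h).length_eq, ih _ h₁, ih _ h₂]
    ring

open scoped ENNReal

theorem PMF.tsum_bind_mul {α β : Type*} (p : PMF α) (q : α → PMF β) (g : β → ℝ≥0∞) :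
    ∑' b, p.bind q b * g b = ∑' a, p a * ∑' b, q a b * g b := by
  simp only [PMF.bind_apply, ← ENNReal.tsum_mul_right, ← ENNReal.tsum_mul_left, mul_assoc]
  exact ENNReal.tsum_comm

theorem PMF.tsum_map_mul {α β : Type*} (p : PMF α) (φ : α → β) (g : β → ℝ≥0∞) :
    ∑' b, p.map φ b * g b = ∑' a, p a * g (φ a) := by
  rw [← PMF.bind_pure_comp, PMF.tsum_bind_mul]
  refine tsum_congr fun a => ?_
  congr 1
  rw [tsum_eq_single (φ a)]
  · simp
  · intro b hb
    simp [hb]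

theorem PMF.tsum_mul_congr {α : Type*} (p : PMF α) {g g' : α → ℝ≥0∞}
    (h : ∀ a ∈ p.support, g a = g' a) : ∑' a, p a * g a = ∑' a, p a * g' a := by
  refine tsum_congr fun a => ?_
  by_cases ha : p a = 0
  · simp [ha]
  · rw [h a ((PMF.mem_support_iff _ _).2 ha)]

theorem signSumMean_eq_sum (l : ℕ) (f : ℤ → ℝ) :
    signSumMean l f = (1 / 2) ^ l * ∑ ω : Fin l → ℤˣ, f (height (List.ofFn ω)) := by
  induction l generalizing f with
  | zero => simp [signSumMean_zero, height]
  | succ l ih =>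
    rw [signSumMean_succ, ih, ih, ← (Fin.consEquiv fun _ => ℤˣ).sum_comp, Fintype.sum_prod_type]
    have h : ∀ (u : ℤˣ) (ω : Fin l → ℤˣ),
        height (List.ofFn ((Fin.consEquiv fun _ => ℤˣ) (u, ω))) =
          height (List.ofFn ω) + u := by
      intro u ω
      simp [height, List.ofFn_succ, Fin.consEquiv, add_comm]
    simp only [h]
    have hu : (Finset.univ : Finset ℤˣ) = {1, -1} := rfl
    rw [hu, Finset.sum_pair (by decide)]
    simp only [Units.val_one, Units.val_neg, ← sub_eq_add_neg]
    ring

theorem IsSymmMean.nonneg {n : ℕ} {E : (ℤ → ℝ) →ₗ[ℝ] ℝ} (h : IsSymmMean n E) {f : ℤ → ℝ}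
    (hf : ∀ x, 0 ≤ f x) : 0 ≤ E f := by
  have := h.mono (fun _ => 0) f fun x _ => hf x
  rwa [h.const] at this

/-- `heightMean` is the expectation of functions of the height of the fractal random walk. -/
theorem tsum_fractalRandomWalk_mul {δ : ℝ} {rd : ℝ → ℕ} (rule : FlipRule δ rd) (l i : ℕ)
    (f : ℤ → ℝ) (hf : ∀ x, 0 ≤ f x) :
    ∑' s, fractalRandomWalk rule l i s * ENNReal.ofReal (f (height s)) =
      ENNReal.ofReal (heightMean δ rd l i f) := by
  induction i generalizing f with
  | zero =>
    simp only [fractalRandomWalk, heightMean]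
    rw [PMF.tsum_map_mul, signSumMean_eq_sum, tsum_fintype,
      ENNReal.ofReal_mul (by positivity), ENNReal.ofReal_sum_of_nonneg fun _ _ => hf _,
      Finset.mul_sum]
    refine Finset.sum_congr rfl fun ω _ => ?_
    congr 1
    rw [PMF.uniformOfFintype_apply, ENNReal.ofReal_pow (by norm_num)]
    simp [ENNReal.inv_pow]
  | succ i ih =>
    have hE := isSymmMean_heightMean δ rd l i
    simp only [fractalRandomWalk, heightMean, pairMean_apply]
    rw [PMF.tsum_bind_mul, ← ih _ fun x => hE.nonneg fun y => hf _]
    refine PMF.tsum_mul_congr _ fun s₁ _ => ?_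
    rw [PMF.tsum_bind_mul, ← ih _ fun y => hf _]
    refine PMF.tsum_mul_congr _ fun s₂ h₂ => ?_
    rw [PMF.tsum_map_mul]
    have h : ∑' s₂', rule.law s₁ s₂ s₂' * ENNReal.ofReal (f (height (s₁ ++ s₂'))) =
        ∑' s₂', rule.law s₁ s₂ s₂' *
          ENNReal.ofReal (f (heightStep δ rd (2 ^ i * l) (height s₁) (height s₂))) :=
      PMF.tsum_mul_congr _ fun s₂' h' => by
        rw [(rule.isUpdate _ _ _ h').height_append_eq
          (length_of_mem_support_fractalRandomWalk rule l i _ h₂)]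
    rw [h, ENNReal.tsum_mul_right, PMF.tsum_coe, one_mul]

theorem prob_height_mem {δ : ℝ} {rd : ℝ → ℕ} (rule : FlipRule δ rd) (l i : ℕ) (A : Set ℤ) :
    prob (fractalRandomWalk rule l i) {s | height s ∈ A} =
      heightMean δ rd l i (A.indicator fun _ => 1) := by
  have h0 : ∀ x, 0 ≤ A.indicator (fun _ => (1 : ℝ)) x := fun x =>
    Set.indicator_nonneg (fun _ _ => zero_le_one) x
  rw [prob, PMF.toOuterMeasure_apply,
    ← ENNReal.toReal_ofReal ((isSymmMean_heightMean δ rd l i).nonneg h0),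
    ← tsum_fractalRandomWalk_mul rule l i _ h0]
  congr 1
  refine tsum_congr fun s => ?_
  by_cases h : height s ∈ A <;> simp [h]

/-! ### Anticoncentration of the height -/

section smallBall

variable {δ : ℝ} {rd : ℝ → ℕ} {l : ℕ}

theorem sqMoment_heightMean_add_le (hδ : 0 ≤ δ) (hδ' : δ ≤ 1 / 10000) (hrd : IsRounding rd)
    (hl : 1000000 ≤ l) (j q : ℕ) :
    sqMoment (heightMean δ rd l (j + q)) ≤ 4 ^ q * sqMoment (heightMean δ rd l j) := by
  induction q with
  | zero => simp
  | succ q ih =>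
    have h1 := sqMoment_pairMean_le_four_mul (isSymmMean_heightMean δ rd l (j + q))
      (heightMean_growth hδ hδ' hrd hl (j + q)).1 hδ hδ' hrd
      (hl.trans (Nat.le_mul_of_pos_left _ (by positivity)))
    calc _ ≤ _ := h1
      _ ≤ 4 * (4 ^ q * sqMoment (heightMean δ rd l j)) := by gcongr
      _ = _ := by ring

theorem le_sqrt_sqMoment (hδ : 0 ≤ δ) (hδ' : δ ≤ 1 / 10000) (hrd : IsRounding rd)
    (hl : 1000000 ≤ l) (j : ℕ) : 700 ≤ √(sqMoment (heightMean δ rd l j)) := by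
  have hn : 1000000 ≤ 2 ^ j * l := hl.trans (Nat.le_mul_of_pos_left _ (by positivity))
  have hN : (1000000 : ℝ) ≤ (2 ^ j * l : ℕ) := by exact_mod_cast hn
  have := (heightMean_growth hδ hδ' hrd hl j).1.le_sqMoment
  exact Real.le_sqrt_of_sq_le (by linarith)

/-- At frequencies of the order of the inverse standard deviation, five doubling steps make the
characteristic function small. -/
theorem charFn_heightMean_add_five_le (hδ : 0 ≤ δ) (hδ' : δ ≤ 1 / 10000) (hrd : IsRounding rd)
    (hl : 1000000 ≤ l) (j : ℕ) {s : ℝ} (hs : 1 / 2 ≤ s) (hs' : s ≤ 1) :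
    charFn (heightMean δ rd l (j + 5)) (s / √(sqMoment (heightMean δ rd l j))) ≤ 0.05 := by
  have hσ := le_sqrt_sqMoment hδ hδ' hrd hl j
  have hE := isSymmMean_heightMean δ rd l j
  have hf := (heightMean_growth hδ hδ' hrd hl j).1.fourthMoment_le
  have hσ2 : √(sqMoment (heightMean δ rd l j)) ^ 2 = sqMoment (heightMean δ rd l j) :=
    Real.sq_sqrt ((sq_nonneg _).trans hE.absMoment_sq_le)
  have hm : ∀ q ≤ 4, absMoment (heightMean δ rd l (j + q)) ≤
      16 * √(sqMoment (heightMean δ rd l j)) := by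
    intro q hq
    refine le_of_sq_le_sq ?_ (by positivity)
    refine (isSymmMean_heightMean δ rd l (j + q)).absMoment_sq_le.trans ?_
    refine (sqMoment_heightMean_add_le hδ hδ' hrd hl j q).trans ?_
    rw [mul_pow, hσ2]
    have : (4 : ℝ) ^ q ≤ 4 ^ 4 := pow_le_pow_right₀ (by norm_num) hq
    have h0 : 0 ≤ sqMoment (heightMean δ rd l j) := by rw [← hσ2]; positivity
    calc _ ≤ 4 ^ 4 * sqMoment (heightMean δ rd l j) := by gcongr
      _ = _ := by norm_num
  have h0 : |charFn (heightMean δ rd l j) (s / √(sqMoment (heightMean δ rd l j)))| ≤ 0.886 := by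
    have h1 := hE.charFn_le (s / √(sqMoment (heightMean δ rd l j)))
    have h2 := hE.le_charFn (s / √(sqMoment (heightMean δ rd l j)))
    have h3 : (s / √(sqMoment (heightMean δ rd l j))) ^ 2 * sqMoment (heightMean δ rd l j)
        = s ^ 2 := by
      rw [div_pow, hσ2, div_mul_cancel₀]
      rw [← hσ2]; positivity
    have h4 : (s / √(sqMoment (heightMean δ rd l j))) ^ 4 *
        fourthMoment (heightMean δ rd l j) ≤ 4 * s ^ 4 := by
      calc _ ≤ (s / √(sqMoment (heightMean δ rd l j))) ^ 4 *
            (4 * sqMoment (heightMean δ rd l j) ^ 2) := by gcongr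
        _ = 4 * ((s / √(sqMoment (heightMean δ rd l j))) ^ 2 *
            sqMoment (heightMean δ rd l j)) ^ 2 := by ring
        _ = _ := by rw [h3]; ring
    have h5 : 1 / 4 ≤ s ^ 2 := by nlinarith
    have h6 : s ^ 2 ≤ 1 := by nlinarith
    rw [abs_le]
    constructor <;> nlinarith
  -- One step squares the characteristic function up to `2 * δ * 16 + 2 / 700 ≤ 0.01`.
  have hstep : ∀ q ≤ 4, ∀ b c : ℝ, b ^ 2 + 0.01 ≤ c →
      |charFn (heightMean δ rd l (j + q)) (s / √(sqMoment (heightMean δ rd l j)))| ≤ b →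
      |charFn (heightMean δ rd l (j + (q + 1))) (s / √(sqMoment (heightMean δ rd l j)))| ≤ c := by
    intro q hq b c hbc hb
    have h1 : |charFn (heightMean δ rd l (j + (q + 1))) _ - _| ≤ _ :=
      abs_charFn_pairMean_sub_le (isSymmMean_heightMean δ rd l (j + q)) hδ hrd
        (t := s / √(sqMoment (heightMean δ rd l j))) (by positivity)
    have h2 : s / √(sqMoment (heightMean δ rd l j)) *
        (2 * δ * absMoment (heightMean δ rd l (j + q)) + 2) ≤ 0.01 := by
      have h4 : 2 * δ * absMoment (heightMean δ rd l (j + q)) ≤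
          2 * (1 / 10000) * (16 * √(sqMoment (heightMean δ rd l j))) := by
        have := (isSymmMean_heightMean δ rd l (j + q)).absMoment_nonneg
        gcongr
        exact hm q hq
      rw [div_mul_eq_mul_div, div_le_iff₀ (by linarith)]
      nlinarith
    have h3 := pow_le_pow_left₀ (abs_nonneg _) hb 2
    rw [sq_abs] at h3
    have h5 := sq_nonneg (charFn (heightMean δ rd l (j + q)) (s / √(sqMoment (heightMean δ rd l j))))
    rw [abs_le] at h1 ⊢
    constructor <;> linarith
  have h1 := hstep 0 (by norm_num) 0.886 0.796 (by norm_num) h0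
  have h2 := hstep 1 (by norm_num) _ 0.645 (by norm_num) h1
  have h3 := hstep 2 (by norm_num) _ 0.427 (by norm_num) h2
  have h4 := hstep 3 (by norm_num) _ 0.193 (by norm_num) h3
  exact (abs_le.1 (hstep 4 (by norm_num) _ 0.05 (by norm_num) h4)).2

/-- The test function `((1 + 2 * cos u) / 3) ^ 2` is close to `1` for small `u`, and has mean `1 / 3`
over a period; so the small values have probability little more than `1 / 3`. -/
theorem heightMean_small_le (hδ : 0 ≤ δ) (hδ' : δ ≤ 1 / 10000) (hrd : IsRounding rd)
    (hl : 1000000 ≤ l) (j : ℕ) :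
    heightMean δ rd l (j + 5) ({x : ℤ | |(x : ℝ)| < √(sqMoment (heightMean δ rd l j)) / 5}.indicator
      fun _ => 1) ≤ 0.4 := by
  have hσ := le_sqrt_sqMoment hδ hδ' hrd hl j
  have hE := isSymmMean_heightMean δ rd l (j + 5)
  have h1 := charFn_heightMean_add_five_le hδ hδ' hrd hl j (s := 1 / 2) le_rfl (by norm_num)
  have h2 := charFn_heightMean_add_five_le hδ hδ' hrd hl j (s := 1) (by norm_num) le_rfl
  generalize √(sqMoment (heightMean δ rd l j)) = σ at *
  -- `((1 + 2 * cos u) / 3) ^ 2 = 1 / 3 + 4 / 9 * cos u + 2 / 9 * cos (2 * u)`, and it is at least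
  -- `0.99` for `|u| ≤ 1 / 10`.
  have h3 : 0.99 * heightMean δ rd l (j + 5)
      ({x : ℤ | |(x : ℝ)| < σ / 5}.indicator fun _ => 1) ≤
      1 / 3 + (4 / 9 * charFn (heightMean δ rd l (j + 5)) (1 / 2 / σ) +
        2 / 9 * charFn (heightMean δ rd l (j + 5)) (1 / σ)) := by
    unfold charFn
    rw [← mean_mul, ← mean_mul, ← mean_mul, ← mean_add, ← hE.const (1 / 3), ← mean_add]
    refine hE.mono _ _ fun x _ => ?_
    have h4 : 1 / σ * (x : ℝ) = 2 * (1 / 2 / σ * x) := by ring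
    rw [h4, Real.cos_two_mul]
    by_cases hx : x ∈ {x : ℤ | |(x : ℝ)| < σ / 5}
    · rw [Set.indicator_of_mem hx]
      have hx' : |(x : ℝ)| < σ / 5 := hx
      have h5 : |1 / 2 / σ * (x : ℝ)| ≤ 1 / 10 := by
        rw [abs_mul, abs_of_pos (by positivity)]
        calc 1 / 2 / σ * |(x : ℝ)| ≤ 1 / 2 / σ * (σ / 5) := by gcongr
          _ = 1 / 10 := by field_simp; norm_num
      have h6 := Real.one_sub_sq_div_two_le_cos (x := 1 / 2 / σ * (x : ℝ))
      have h7 := pow_le_pow_left₀ (abs_nonneg _) h5 2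
      rw [sq_abs] at h7
      nlinarith
    · rw [Set.indicator_of_notMem hx]
      nlinarith [sq_nonneg (1 + 2 * Real.cos (1 / 2 / σ * x))]
  linarith

/-- Anticoncentration and Chebyshev's inequality combined. -/
theorem half_le_heightMean_Icc (hδ : 0 ≤ δ) (hδ' : δ ≤ 1 / 10000) (hrd : IsRounding rd)
    (hl : 1000000 ≤ l) {i : ℕ} (hi : 5 ≤ i) {r R : ℝ} (hR : 0 ≤ R)
    (hra : r ^ 2 ≤ sqMoment (heightMean δ rd l i) / 25600)
    (haR : 16 * sqMoment (heightMean δ rd l i) ≤ R ^ 2) :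
    1 / 2 ≤ heightMean δ rd l i
      ({x : ℤ | r ≤ |(x : ℝ)| ∧ |(x : ℝ)| ≤ R}.indicator fun _ => 1) := by
  obtain ⟨j, rfl⟩ : ∃ j, i = j + 5 := ⟨i - 5, by omega⟩
  have h1 := heightMean_small_le hδ hδ' hrd hl j
  have h2 := sqMoment_heightMean_add_le hδ hδ' hrd hl j 5
  have hE := isSymmMean_heightMean δ rd l (j + 5)
  have hσ := le_sqrt_sqMoment hδ hδ' hrd hl (j + 5)
  have ha : 0 < sqMoment (heightMean δ rd l (j + 5)) := Real.sqrt_pos.1 (by linarith)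
  have hr : r ≤ √(sqMoment (heightMean δ rd l j)) / 5 := by
    refine le_of_sq_le_sq ?_ (by positivity)
    rw [div_pow, Real.sq_sqrt]
    · linarith
    · exact (sq_nonneg _).trans (isSymmMean_heightMean δ rd l j).absMoment_sq_le
  have hR0 : 0 < R ^ 2 := by linarith
  set B := {x : ℤ | |(x : ℝ)| < √(sqMoment (heightMean δ rd l j)) / 5}
  set A := {x : ℤ | r ≤ |(x : ℝ)| ∧ |(x : ℝ)| ≤ R}
  have h3 : 1 ≤ heightMean δ rd l (j + 5) (A.indicator fun _ => 1) +
      heightMean δ rd l (j + 5) (B.indicator fun _ => 1) +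
      1 / R ^ 2 * sqMoment (heightMean δ rd l (j + 5)) := by
    unfold sqMoment
    rw [← mean_mul, ← mean_add, ← mean_add]
    refine hE.one.symm.le.trans (hE.mono _ _ fun x _ => ?_)
    have hA0 : 0 ≤ A.indicator (fun _ => (1 : ℝ)) x :=
      Set.indicator_nonneg (fun _ _ => zero_le_one) x
    have hB0 : 0 ≤ B.indicator (fun _ => (1 : ℝ)) x :=
      Set.indicator_nonneg (fun _ _ => zero_le_one) x
    have hx0 : 0 ≤ 1 / R ^ 2 * (x : ℝ) ^ 2 := by positivity
    by_cases hB : x ∈ B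
    · have : B.indicator (fun _ => (1 : ℝ)) x = 1 := Set.indicator_of_mem hB _
      linarith
    by_cases hx : |(x : ℝ)| ≤ R
    · have hA : x ∈ A := ⟨hr.trans (not_lt.1 hB), hx⟩
      have : A.indicator (fun _ => (1 : ℝ)) x = 1 := Set.indicator_of_mem hA _
      linarith
    · have h4 : 1 ≤ 1 / R ^ 2 * (x : ℝ) ^ 2 := by
        rw [one_div_mul_eq_div, one_le_div hR0, ← sq_abs (x : ℝ)]
        exact pow_le_pow_left₀ hR (not_le.1 hx).le 2
      linarith
  have h4 : 1 / R ^ 2 * sqMoment (heightMean δ rd l (j + 5)) ≤ 1 / 16 := by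
    rw [one_div_mul_eq_div, div_le_iff₀ hR0]
    linarith
  linarith

end smallBall

/-! ### From the standard deviation to powers of the length -/

theorem exp_half_mul_le_one_add_pow {δ : ℝ} (hδ : 0 ≤ δ) (hδ' : δ ≤ 1) (i : ℕ) :
    Real.exp (δ * i / 2) ≤ (1 + δ) ^ i := by
  have h : Real.exp (δ / 2) ≤ 1 + δ := by
    have h1 := Real.add_one_le_exp (-(δ / 2))
    have h2 : Real.exp (δ / 2) * Real.exp (-(δ / 2)) = 1 := by
      rw [← Real.exp_add, add_neg_cancel, Real.exp_zero]
    nlinarith [Real.exp_pos (δ / 2)]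
  calc Real.exp (δ * i / 2) = Real.exp (δ / 2) ^ i := by rw [← Real.exp_nat_mul]; ring_nf
    _ ≤ _ := by gcongr

theorem one_add_pow_le_exp {δ : ℝ} (hδ : 0 ≤ δ) (i : ℕ) :
    (1 + 3 * δ) ^ i ≤ Real.exp (3 * δ * i) := by
  calc (1 + 3 * δ) ^ i ≤ Real.exp (3 * δ) ^ i := by
        gcongr
        linarith [Real.add_one_le_exp (3 * δ)]
    _ = _ := by rw [← Real.exp_nat_mul]; ring_nf

/-- The variance of the height, in terms of the length `T` only: the number of steps is between
`log T / 2` and `2 * log T` as the base length is at most `√T`. -/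
theorem sqMoment_heightMean_bounds {δ : ℝ} {rd : ℝ → ℕ} (hδ : 0 ≤ δ) (hδ' : δ ≤ 1 / 10000)
    (hrd : IsRounding rd) {T l i : ℕ} (hT : T = 2 ^ i * l) (hl : 1000000 ≤ l)
    (hlT : (l : ℝ) ≤ √(T : ℝ)) :
    5 ≤ i ∧ T * Real.exp (δ * Real.log T / 4) / 2 ≤ sqMoment (heightMean δ rd l i) ∧
      sqMoment (heightMean δ rd l i) ≤ 2 * T * Real.exp (6 * δ * Real.log T) := by
  have hL : (1000000 : ℝ) ≤ l := by exact_mod_cast hl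
  have hT' : (T : ℝ) = 2 ^ i * l := by exact_mod_cast hT
  have hpow : (l : ℝ) ≤ 2 ^ i := by
    have h1 := (Real.le_sqrt (by linarith) (by positivity)).1 hlT
    rw [hT', sq] at h1
    exact le_of_mul_le_mul_right h1 (by linarith)
  have hlog2 := Real.log_two_lt_d9
  have hlog2' := Real.log_two_gt_d9
  have hi1 : Real.log T ≤ 2 * i := by
    have h1 : Real.log T ≤ Real.log (2 ^ i * 2 ^ i) := by
      apply Real.log_le_log
      · rw [hT']; positivity
      · rw [hT']; gcongr
    rw [← pow_add, Real.log_pow] at h1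
    push_cast at h1
    nlinarith
  have hi2 : (i : ℝ) ≤ 2 * Real.log T := by
    have h1 : Real.log (2 ^ i) ≤ Real.log T := by
      apply Real.log_le_log (by positivity)
      rw [hT']
      exact le_mul_of_one_le_right (by positivity) (by linarith)
    rw [Real.log_pow] at h1
    nlinarith
  obtain ⟨-, hlo, hup⟩ := heightMean_growth hδ hδ' hrd hl i
  have hx : 0 ≤ (3 / 4 : ℝ) ^ i / √l := by positivity
  rw [← hT'] at hlo hup
  refine ⟨?_, ?_, ?_⟩
  · by_contra! h
    have h1 : (2 : ℝ) ^ i ≤ 2 ^ 4 := pow_le_pow_right₀ (by norm_num) (by omega)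
    linarith
  · have h1 : Real.exp (δ * Real.log T / 4) ≤ (1 + δ) ^ i := by
      refine le_trans (Real.exp_le_exp.2 ?_) (exp_half_mul_le_one_add_pow hδ (by linarith) i)
      nlinarith
    refine le_trans ?_ hlo
    calc (T : ℝ) * Real.exp (δ * Real.log T / 4) / 2
        = T * Real.exp (δ * Real.log T / 4) * (1 / 2 * 1) := by ring
      _ ≤ _ := by gcongr; linarith
  · have h1 : (1 + 3 * δ) ^ i ≤ Real.exp (6 * δ * Real.log T) := by
      refine (one_add_pow_le_exp hδ i).trans (Real.exp_le_exp.2 ?_)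
      nlinarith
    refine hup.trans ?_
    calc _ ≤ (T : ℝ) * (1 + 3 * δ) ^ i * 2 := by gcongr; linarith
      _ ≤ T * Real.exp (6 * δ * Real.log T) * 2 := by gcongr
      _ = _ := by ring

theorem sq_rpow_half_add {T : ℝ} (hT : 0 < T) (c : ℝ) :
    (T ^ (1 / 2 + c)) ^ 2 = T * Real.exp (2 * c * Real.log T) := by
  rw [← Real.rpow_natCast, ← Real.rpow_mul hT.le,
    show (1 / 2 + c) * ((2 : ℕ) : ℝ) = 1 + 2 * c by push_cast; ring, Real.rpow_add hT,
    Real.rpow_one, Real.rpow_def_of_pos hT, mul_comm (Real.log T)]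

/-- The factor `b ^ 2 * T ^ (δ / 8)` has to absorb all constants: `2 * 25600` for the lower bound,
`2 * 16` for the upper one. -/
theorem half_le_prob_height {δ : ℝ} {rd : ℝ → ℕ} (hδ : 0 ≤ δ) (hδ' : δ ≤ 1 / 10000)
    (hrd : IsRounding rd) (rule : FlipRule δ rd) {T l i : ℕ} (hT : T = 2 ^ i * l)
    (hl : 1000000 ≤ l) (hlT : (l : ℝ) ≤ √(T : ℝ)) {b : ℝ} (hb : 1 ≤ b)
    (hbe : 51200 ≤ b ^ 2 * Real.exp (δ * Real.log T / 8)) :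
    1 / 2 ≤ prob (fractalRandomWalk rule l i)
      {s | b⁻¹ * (T : ℝ) ^ (1 / 2 + 1 / 16 * δ) ≤ |(height s : ℝ)| ∧
        |(height s : ℝ)| ≤ b * (T : ℝ) ^ (1 / 2 + 4 * δ)} := by
  obtain ⟨hi, hlo, hup⟩ := sqMoment_heightMean_bounds hδ hδ' hrd hT hl hlT
  have hT0 : (0 : ℝ) < T := by
    have : 0 < l := by omega
    rw [hT]; positivity
  have h := prob_height_mem rule l i {x : ℤ | b⁻¹ * (T : ℝ) ^ (1 / 2 + 1 / 16 * δ) ≤ |(x : ℝ)| ∧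
        |(x : ℝ)| ≤ b * (T : ℝ) ^ (1 / 2 + 4 * δ)}
  refine le_of_le_of_eq ?_ h.symm
  have hLT : 0 ≤ Real.log T := Real.log_natCast_nonneg T
  have hu : 0 ≤ δ * Real.log T := mul_nonneg hδ hLT
  apply half_le_heightMean_Icc hδ hδ' hrd hl hi (by positivity)
  · rw [mul_pow, sq_rpow_half_add hT0]
    refine le_trans ?_ (div_le_div_of_nonneg_right hlo (by norm_num))
    rw [inv_pow, inv_mul_le_iff₀ (by positivity),
      show 2 * (1 / 16 * δ) * Real.log T = δ * Real.log T / 8 by ring,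
      show δ * Real.log T / 4 = δ * Real.log T / 8 + δ * Real.log T / 8 by ring, Real.exp_add]
    set e := Real.exp (δ * Real.log T / 8)
    calc (T : ℝ) * e = T * e * 51200 / 51200 := by ring
      _ ≤ T * e * (b ^ 2 * e) / 51200 := by gcongr
      _ = _ := by ring
  · rw [mul_pow, sq_rpow_half_add hT0]
    have h1 : b ^ 2 * Real.exp (δ * Real.log T / 8) ≤ b ^ 2 * Real.exp (2 * δ * Real.log T) := by
      gcongr ?_ * Real.exp ?_
      linarith
    rw [show 2 * (4 * δ) * Real.log T = 2 * δ * Real.log T + 6 * δ * Real.log T by ring,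
      Real.exp_add]
    calc _ ≤ 16 * (2 * T * Real.exp (6 * δ * Real.log T)) := by gcongr
      _ = T * Real.exp (6 * δ * Real.log T) * 32 := by ring
      _ ≤ T * Real.exp (6 * δ * Real.log T) * (b ^ 2 * Real.exp (2 * δ * Real.log T)) := by
          gcongr
          linarith
      _ = _ := by ring

theorem mainTheorem7 :
    ∃ δ₀ c₁ c₂ C K : ℝ, ∃ T₀ : ℕ, 0 < δ₀ ∧ 0 < c₁ ∧ 0 < c₂ ∧ 0 < C ∧ 0 < K ∧
      ∀ δ : ℝ, 0 < δ → δ ≤ δ₀ →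
      ∀ rd : ℝ → ℕ, IsRounding rd →
      ∀ rule : FlipRule δ rd,
      ∀ T l i : ℕ, T = 2 ^ i * l → 100 * Real.log (T : ℝ) ≤ (l : ℝ) → (l : ℝ) ≤ Real.sqrt (T : ℝ) →
        (K ≤ δ * Real.log (T : ℝ) →
          1 / 2 - (T : ℝ) ^ (-10 : ℤ) ≤
            prob (fractalRandomWalk rule l i)
              {s | (T : ℝ) ^ (1 / 2 + c₁ * δ) ≤ |(height s : ℝ)| ∧
                |(height s : ℝ)| ≤ (T : ℝ) ^ (1 / 2 + c₂ * δ)}) ∧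
        (T₀ ≤ T →
          1 / 2 - (T : ℝ) ^ (-10 : ℤ) ≤
            prob (fractalRandomWalk rule l i)
              {s | C⁻¹ * (T : ℝ) ^ (1 / 2 + c₁ * δ) ≤ |(height s : ℝ)| ∧
                |(height s : ℝ)| ≤ C * (T : ℝ) ^ (1 / 2 + c₂ * δ)}) := by

  -- `300 ^ 2 ≥ 51200` and `exp (100 / 8) ≥ 51200`, as `half_le_prob_height` requires; the height is
  -- controlled with probability `1 / 2` even without the term `T ^ (-10)`.
  refine ⟨1 / 10000, 1 / 16, 4, 300, 100, ⌈Real.exp 10000⌉₊, by norm_num, by norm_num, by norm_num,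
    by norm_num, by norm_num, ?_⟩
  intro δ hδ hδ' rd hrd rule T l i hT hl hlT
  have hzpow : (0 : ℝ) ≤ (T : ℝ) ^ (-10 : ℤ) := by positivity
  have hbase : 10000 ≤ Real.log T → 1000000 ≤ l := fun h => by
    have : (1000000 : ℝ) ≤ l := by linarith
    exact_mod_cast this
  constructor
  · intro hK
    have hlog : 10000 ≤ Real.log T := by nlinarith
    have he : 51200 ≤ Real.exp (δ * Real.log T / 8) := by
      calc (51200 : ℝ) ≤ 2.7 ^ 12 := by norm_num
        _ ≤ Real.exp 1 ^ 12 := by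
            gcongr
            linarith [Real.exp_one_gt_d9]
        _ = Real.exp 12 := by rw [← Real.exp_nat_mul]; norm_num
        _ ≤ _ := by
            gcongr
            linarith
    have h := half_le_prob_height hδ.le hδ' hrd rule hT (hbase hlog) hlT (b := 1) le_rfl
      (by linarith)
    simp only [inv_one, one_mul] at h
    linarith
  · intro hT0
    have h1 : Real.exp 10000 ≤ T := Nat.ceil_le.1 hT0
    have hlog : 10000 ≤ Real.log T := (Real.le_log_iff_exp_le ((Real.exp_pos _).trans_le h1)).2 h1
    have he : 1 ≤ Real.exp (δ * Real.log T / 8) := Real.one_le_exp (by positivity)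
    have h := half_le_prob_height hδ.le hδ' hrd rule hT (hbase hlog) hlT (b := 300) (by norm_num)
      (by linarith)
    linarith
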